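/- Let $0<\alpha<1$. For $t>0$ and $x\in\mathbb{R}$ let $$K(t,x)=\mathcal F^{-1}\left(e^{(i\xi)^{\alpha+1}t}\right)(x)=\frac1{2\pi}\int_{\mathbb R}e^{(i\xi)^{\alpha+1}t}\,e^{i\xi x}\,d\xi ,$$ where $(i\xi)^{\alpha+1}$ is the principal branch of the power, and $\mathcal F^{-1}$ is the inverse of $\mathcal F(u)(\xi)=\int_{\mathbb R}u(x)e^{-i\xi x}\,dx$. Then $K$ is real-valued and non-negative, and it has the following properties, in which $\|\cdot\|_1$ is the norm of $L^1(\mathbb R)$ in $x$, $*$ is the convolution $(f*g)(x)=\int_{\mathbb R}f(y)g(x-y)\,dy$, and all constants depend only on $\alpha$ and $m$. (i) Self-similarity: for all $t>0$ and $x\in\mathbb R$, $$K(t,x)=\frac1{t^{\frac1{1+\alpha}}}\,K\left(1,\frac{x}{t^{\frac1{1+\alpha}}}\right).$$ (ii) Mass conservation: for all $t>0$, $K(t,\cdot)\in L^1(\mathbb R)$ and $\|K(t,\cdot)\|_1=1$. (iii) Semigroup property: for all $a,b\in(0,\infty)$, $$K(a,\cdot)*K(b,\cdot)=K(a+b,\cdot)\quad\text{and}\quad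 K(a,\cdot)*\partial_xK(b,\cdot)=\partial_x\left(K(a+b,\cdot)\right)$$ at every point of $\mathbb R$, the convolution integrals being absolutely convergent. (iv) Space regularity: $K\in C^\infty((0,\infty)\times\mathbb R)$, and for every integer $m\ge0$ there is $B_m>0$ such that $$|\partial_x^mK(t,x)|\le\frac1{t^{\frac{1+m}{1+\alpha}}}\,\frac{B_m}{1+t^{-\frac{m+2}{1+\alpha}}|x|^{m+2}}\quad\text{for all }(t,x)\in(0,\infty)\times\mathbb R.$$ Moreover, for every integer $m\ge1$ there is $C_m>0$ such that for all $t>0$, $\partial_x^mK(t,\cdot)\in L^1(\mathbb R)$ and $$\|\partial_x^mK(t,\cdot)\|_1=\frac{C_m}{t^{\frac m{1+\alpha}}}.$$ (v) Time regularity: for every integer $m\ge0$ there is $K_m>0$ such that $$|\partial_t^mK(t,x)|\le\frac1{t^{\frac{m(\alpha+1)+1}{\alpha+1}}}\,\frac{K_m}{1+\left(\frac{|x|}{t^{1/(\alpha+1)}}\right)^2}\quad\text{for all }(t,x)\in(0,\infty)\times\mathbb R,$$ and for every integer $m\ge0$ there is $D_m>0$ such that for all $t>0$, $\partial_t^mK(t,\cdot)\in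 L^1(\mathbb R)$ and $$\|\partial_t^mK(t,\cdot)\|_1=\frac{D_m}{t^m}.$$ -/

import Mathlib

open MeasureTheory Set
open scoped ContDiff Convolution

noncomputable section

/-- The inverse of the Fourier transform `u ↦ ∫ u(x) e^{-iξx} dx` on the line:
`(1 / 2π) ∫ g(ξ) e^{iξx} dξ`. -/
def invFourierLine (g : ℝ → ℂ) (x : ℝ) : ℂ :=
  (1 / (2 * (Real.pi : ℂ))) * ∫ ξ : ℝ, g ξ * Complex.exp (Complex.I * (ξ : ℂ) * (x : ℂ))

/-- The Fourier symbol `(iξ)^{α+1}` (principal branch of the complex power). -/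
def fracSymbol (α ξ : ℝ) : ℂ :=
  (Complex.I * (ξ : ℂ)) ^ ((α : ℂ) + 1)

/-- The kernel `K(t, ·) = 𝓕⁻¹ (e^{(iξ)^{α+1} t})`. -/
def fracKernel (α t x : ℝ) : ℂ :=
  invFourierLine (fun ξ => Complex.exp (fracSymbol α ξ * (t : ℂ))) x

end

/-! Everything is read off the family M_p(t, x) = 𝓕⁻¹((iξ)^p e^{t(iξ)^(α+1)})(x), called
`fracMoment`. As (α+1)π/2 lies strictly between π/2 and π, the symbol has real part -c|ξ|^(α+1) with
c > 0, so the integrals converge for t > 0 and p > -1. The family is closed under every operation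
needed: ∂_x adds 1 to p and ∂_t adds α+1 (`hasFDerivAt_fracMoment`), dilation reduces t to 1
(`fracMoment_scaling`), and integration by parts gives x M_p = -(p M_{p-1} + t(α+1) M_{p+α})
(`mul_fracMoment`). Iterating that identity yields decay, hence integrability; Fourier inversion
then gives the semigroup law and ∫ K = 1, and scaling gives the exact L¹ norms.

Non-negativity comes from shifted Grünwald–Letnikov differences. With b = α+1, (iξ)^b is the limit
of h^(-b) z⁻¹ (1-z)^b, where z = e^{-(h²+ihξ)} and h → 0. For 1 ≤ b ≤ 2 the only negative
coefficient in the expansion of z⁻¹ (1-z)^b is the constant one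
(`isPositiveMultiplier_one_sub_cpow`). The exponential is therefore a limit of positive constants
times exponentials of positive combinations of characters, and positivity of the
Gaussian-regularised inverse transform survives these operations. -/

/-! ### Size, integrability and algebra of the Fourier side -/

open Complex in
theorem fracSymbol_re {α : ℝ} (hα : 0 < α) (ξ : ℝ) :
    (fracSymbol α ξ).re = |ξ| ^ (α + 1) * Real.cos ((α + 1) * (Real.pi / 2)) := by
  have h : fracSymbol α ξ = (I * (ξ : ℂ)) ^ ((α + 1 : ℝ) : ℂ) := by simp [fracSymbol]
  rw [h, cpow_ofReal_re]
  have hn : ‖I * (ξ : ℂ)‖ = |ξ| := by simp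
  rw [hn]
  rcases lt_trichotomy ξ 0 with h0 | rfl | h0
  · have : arg (I * (ξ : ℂ)) = -(Real.pi / 2) := by
      have e : I * (ξ : ℂ) = ((-ξ : ℝ) : ℂ) * (-I) := by push_cast; ring
      rw [e, arg_real_mul _ (by linarith), arg_neg_I]
    rw [this, neg_mul, Real.cos_neg, mul_comm (α + 1)]
  · rw [abs_zero, Real.zero_rpow (by linarith)]; simp
  · have : arg (I * (ξ : ℂ)) = Real.pi / 2 := by
      rw [mul_comm, arg_real_mul _ h0, arg_I]
    rw [this, mul_comm (α + 1)]

/-- The rate `-cos ((α + 1) π / 2)` at which `exp (t (iξ)^(α+1))` decays. -/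
noncomputable def fracRate (α : ℝ) : ℝ := -Real.cos ((α + 1) * (Real.pi / 2))

theorem fracRate_pos {α : ℝ} (hα0 : 0 < α) (hα1 : α < 1) : 0 < fracRate α := by
  have hpi := Real.pi_pos
  have := Real.cos_neg_of_pi_div_two_lt_of_lt (x := (α + 1) * (Real.pi / 2)) (by nlinarith)
    (by nlinarith)
  unfold fracRate; linarith

/-- The Fourier side `(iξ)^p e^{t (iξ)^(α+1)}` of the derivatives of the kernel. -/
noncomputable def fracDensity (α p t ξ : ℝ) : ℂ :=
  (Complex.I * (ξ : ℂ)) ^ (p : ℂ) * Complex.exp (fracSymbol α ξ * (t : ℂ))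

/-- The inverse Fourier transform of `(iξ)^p e^{t (iξ)^(α+1)}`. -/
noncomputable def fracMoment (α p t x : ℝ) : ℂ := invFourierLine (fracDensity α p t) x

theorem fracMoment_zero (α t x : ℝ) : fracMoment α 0 t x = fracKernel α t x := by
  simp [fracMoment, fracKernel, fracDensity, invFourierLine]

theorem norm_fracDensity {α : ℝ} (hα : 0 < α) (p t ξ : ℝ) :
    ‖fracDensity α p t ξ‖ = |ξ| ^ p * Real.exp (-(fracRate α * t) * |ξ| ^ (α + 1)) := by
  rw [fracDensity, norm_mul, Complex.norm_cpow_real, Complex.norm_exp, Complex.re_mul_ofReal,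
    fracSymbol_re hα]
  congr 1
  · simp
  · unfold fracRate; congr 1; ring

@[fun_prop]
theorem measurable_fracDensity (α p t : ℝ) : Measurable (fracDensity α p t) := by
  unfold fracDensity fracSymbol; fun_prop

@[fun_prop]
theorem measurable_fracSymbol (α : ℝ) : Measurable (fracSymbol α) := by
  unfold fracSymbol; fun_prop

theorem integrable_comp_abs_of_integrableOn_Ioi {f : ℝ → ℝ} (hf : IntegrableOn f (Ioi 0)) :
    Integrable fun x => f |x| := by
  rw [← integrableOn_univ, ← Iio_union_Ici (a := (0 : ℝ)), integrableOn_union,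
    integrableOn_Ici_iff_integrableOn_Ioi]
  constructor
  · have h := ((Measure.measurePreserving_neg (volume : Measure ℝ)).integrableOn_comp_preimage
      (Homeomorph.neg ℝ).measurableEmbedding (f := f) (s := Ioi 0)).2 hf
    have e : (Neg.neg ⁻¹' Ioi (0 : ℝ)) = Iio 0 := by ext; simp
    rw [e] at h
    refine h.congr_fun (fun x hx => ?_) measurableSet_Iio
    simp [abs_of_neg (mem_Iio.1 hx)]
  · refine hf.congr_fun (fun x hx => ?_) measurableSet_Ioi
    simp [abs_of_pos (mem_Ioi.1 hx)]

theorem integrable_norm_fracDensity {α : ℝ} (hα0 : 0 < α) {p c : ℝ}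
    (hp : -1 < p) (hc : 0 < c) :
    Integrable fun ξ : ℝ => |ξ| ^ p * Real.exp (-c * |ξ| ^ (α + 1)) := by
  have := integrableOn_rpow_mul_exp_neg_mul_rpow hp (show 0 < α + 1 by linarith) hc
  exact integrable_comp_abs_of_integrableOn_Ioi this

theorem integrable_fracDensity {α : ℝ} (hα0 : 0 < α) (hα1 : α < 1) {p t : ℝ}
    (hp : -1 < p) (ht : 0 < t) : Integrable (fracDensity α p t) := by
  refine (integrable_norm_fracDensity hα0 hp (mul_pos (fracRate_pos hα0 hα1) ht)).mono'
    (measurable_fracDensity α p t).aestronglyMeasurable (ae_of_all _ fun ξ => ?_)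
  rw [norm_fracDensity hα0]

theorem continuous_fracDensity {α : ℝ} (hα0 : 0 < α) {p : ℝ} (hp : 0 ≤ p) (t : ℝ) :
    Continuous (fracDensity α p t) := by
  have key : ∀ q : ℝ, 0 ≤ q → Continuous fun ξ : ℝ => (Complex.I * (ξ : ℂ)) ^ (q : ℂ) := by
    intro q hq
    rcases hq.eq_or_lt with rfl | hq
    · simpa using continuous_const
    · exact continuous_iff_continuousAt.2 fun ξ => ContinuousAt.comp
        (Complex.continuousAt_cpow_const_of_re_pos (Or.inl (by simp)) (by simpa using hq))
        (by fun_prop)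
  have h1 := key p hp
  have h2 := key (α + 1) (by linarith)
  unfold fracDensity fracSymbol
  push_cast at h2
  fun_prop

/-- The conditions on the exponents matter only at ξ = 0, where the convention 0^0 = 1 would break
the power law. -/
theorem mul_cpow_I_mul {q : ℝ} {p : ℝ} (hq : p + q ≠ 0) (hq0 : q ≠ 0) (ξ : ℝ) :
    (Complex.I * (ξ : ℂ)) ^ (q : ℂ) * (Complex.I * (ξ : ℂ)) ^ (p : ℂ) =
      (Complex.I * (ξ : ℂ)) ^ ((p + q : ℝ) : ℂ) := by
  by_cases h : ξ = 0
  · subst h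
    have h1 : ((p + q : ℝ) : ℂ) ≠ 0 := by exact_mod_cast hq
    have h2 : ((q : ℝ) : ℂ) ≠ 0 := by exact_mod_cast hq0
    rw [Complex.ofReal_zero, mul_zero, Complex.zero_cpow h1, Complex.zero_cpow h2, zero_mul]
  · rw [Complex.ofReal_add, Complex.cpow_add _ _ (by simp [h]), mul_comm]

theorem fracSymbol_mul_fracDensity {α : ℝ} (hα0 : 0 < α) {p : ℝ} (hp : -1 < p) (t ξ : ℝ) :
    fracSymbol α ξ * fracDensity α p t ξ = fracDensity α (p + (α + 1)) t ξ := by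
  have := mul_cpow_I_mul (p := p) (q := α + 1) (by linarith) (by linarith) ξ
  unfold fracDensity fracSymbol at *
  rw [← this, Complex.ofReal_add, Complex.ofReal_one]; ring

theorem I_mul_fracDensity {α : ℝ} {p : ℝ} (hp : -1 < p) (t ξ : ℝ) :
    Complex.I * ξ * fracDensity α p t ξ = fracDensity α (p + 1) t ξ := by
  have := mul_cpow_I_mul (p := p) (q := 1) (by linarith) (by linarith) ξ
  unfold fracDensity
  rw [← this, Complex.ofReal_one, Complex.cpow_one]; ring

theorem norm_exp_I_mul_mul (ξ x : ℝ) :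
    ‖Complex.exp (Complex.I * (ξ : ℂ) * (x : ℂ))‖ = 1 := by
  rw [Complex.norm_exp]; simp

theorem integrable_fracDensity_mul_exp {α : ℝ} (hα0 : 0 < α) (hα1 : α < 1) {p t : ℝ}
    (hp : -1 < p) (ht : 0 < t) (x : ℝ) :
    Integrable fun ξ : ℝ => fracDensity α p t ξ * Complex.exp (Complex.I * (ξ : ℂ) * (x : ℂ)) := by
  refine (integrable_fracDensity hα0 hα1 hp ht).norm.mono' (by fun_prop) (ae_of_all _ fun ξ => ?_)
  rw [norm_mul, norm_exp_I_mul_mul, mul_one]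

/-! ### Differentiation in time and space -/

theorem hasFDerivAt_fracMoment {α : ℝ} (hα0 : 0 < α) (hα1 : α < 1) {p : ℝ} (hp : -1 < p)
    {q : ℝ × ℝ} (hq : 0 < q.1) :
    HasFDerivAt (fun q : ℝ × ℝ => fracMoment α p q.1 q.2)
      ((ContinuousLinearMap.fst ℝ ℝ ℝ).smulRight (fracMoment α (p + (α + 1)) q.1 q.2) +
        (ContinuousLinearMap.snd ℝ ℝ ℝ).smulRight (fracMoment α (p + 1) q.1 q.2)) q := by
  set e : ℝ × ℝ → ℝ → ℂ := fun q ξ => Complex.exp (Complex.I * (ξ : ℂ) * (q.2 : ℂ)) with he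
  set F : ℝ × ℝ → ℝ → ℂ := fun q ξ => fracDensity α p q.1 ξ * e q ξ with hF
  set F' : ℝ × ℝ → ℝ → (ℝ × ℝ →L[ℝ] ℂ) := fun q ξ =>
    (ContinuousLinearMap.fst ℝ ℝ ℝ).smulRight (fracDensity α (p + (α + 1)) q.1 ξ * e q ξ) +
      (ContinuousLinearMap.snd ℝ ℝ ℝ).smulRight (fracDensity α (p + 1) q.1 ξ * e q ξ) with hF'
  -- Staying above half the given time keeps the exponential rate bounded below, so one integrable
  -- function dominates all nearby derivatives.
  have hU : {r : ℝ × ℝ | q.1 / 2 < r.1} ∈ nhds q :=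
    (isOpen_lt continuous_const continuous_fst).mem_nhds (by simp; linarith)
  have hc := fracRate_pos hα0 hα1
  have hle : ∀ s : ℝ, ∀ r ∈ {r : ℝ × ℝ | q.1 / 2 < r.1}, ∀ ξ : ℝ, ‖fracDensity α s r.1 ξ * e r ξ‖ ≤
      |ξ| ^ s * Real.exp (-(fracRate α * (q.1 / 2)) * |ξ| ^ (α + 1)) := by
    intro s r hr ξ
    rw [norm_mul, norm_exp_I_mul_mul, mul_one, norm_fracDensity hα0]
    have h1 : 0 ≤ |ξ| ^ (α + 1) := by positivity
    have h2 : fracRate α * (q.1 / 2) ≤ fracRate α * r.1 :=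
      mul_le_mul_of_nonneg_left (le_of_lt hr) hc.le
    gcongr
  have hint : ∀ s : ℝ, -1 < s → Integrable fun ξ : ℝ =>
      |ξ| ^ s * Real.exp (-(fracRate α * (q.1 / 2)) * |ξ| ^ (α + 1)) := fun s hs =>
    integrable_norm_fracDensity hα0 hs (by positivity)
  have main := hasFDerivAt_integral_of_dominated_of_fderiv_le (μ := volume) (F := F) (F' := F')
    (x₀ := q) (bound := fun ξ =>
      |ξ| ^ (p + (α + 1)) * Real.exp (-(fracRate α * (q.1 / 2)) * |ξ| ^ (α + 1)) +
        |ξ| ^ (p + 1) * Real.exp (-(fracRate α * (q.1 / 2)) * |ξ| ^ (α + 1))) hU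
    (Filter.Eventually.of_forall fun r => by
      apply Measurable.aestronglyMeasurable
      simp only [hF, he]
      fun_prop)
    (integrable_fracDensity_mul_exp hα0 hα1 hp hq q.2)
    (by
      have h1 := (integrable_fracDensity_mul_exp hα0 hα1 (p := p + (α + 1)) (by linarith) hq
        q.2).aestronglyMeasurable
      have h2 := (integrable_fracDensity_mul_exp hα0 hα1 (p := p + 1) (by linarith) hq
        q.2).aestronglyMeasurable
      exact (((ContinuousLinearMap.smulRightL ℝ (ℝ × ℝ) ℂ
        (ContinuousLinearMap.fst ℝ ℝ ℝ)).continuous.comp_aestronglyMeasurable h1).add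
        ((ContinuousLinearMap.smulRightL ℝ (ℝ × ℝ) ℂ
        (ContinuousLinearMap.snd ℝ ℝ ℝ)).continuous.comp_aestronglyMeasurable h2)))
    (ae_of_all _ fun ξ r hr => by
      refine (norm_add_le _ _).trans (add_le_add ?_ ?_)
      · rw [ContinuousLinearMap.norm_smulRight_apply]
        refine le_trans ?_ (hle _ r hr ξ)
        exact mul_le_of_le_one_left (norm_nonneg _) (ContinuousLinearMap.norm_fst_le ..)
      · rw [ContinuousLinearMap.norm_smulRight_apply]
        refine le_trans ?_ (hle _ r hr ξ)
        exact mul_le_of_le_one_left (norm_nonneg _) (ContinuousLinearMap.norm_snd_le ..))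
    ((hint _ (by linarith)).add (hint _ (by linarith)))
    (ae_of_all _ fun ξ r hr => by
      have ht : HasFDerivAt (fun r : ℝ × ℝ => (r.1 : ℂ))
          (Complex.ofRealCLM.comp (ContinuousLinearMap.fst ℝ ℝ ℝ)) r :=
        (Complex.ofRealCLM.comp (ContinuousLinearMap.fst ℝ ℝ ℝ)).hasFDerivAt
      have hx : HasFDerivAt (fun r : ℝ × ℝ => (r.2 : ℂ))
          (Complex.ofRealCLM.comp (ContinuousLinearMap.snd ℝ ℝ ℝ)) r :=
        (Complex.ofRealCLM.comp (ContinuousLinearMap.snd ℝ ℝ ℝ)).hasFDerivAt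
      have h1 := ((ht.const_mul (fracSymbol α ξ)).cexp.const_mul
        ((Complex.I * (ξ : ℂ)) ^ (p : ℂ))).mul (hx.const_mul (Complex.I * (ξ : ℂ))).cexp
      refine h1.congr_fderiv ?_
      ext
      · simp only [hF', ← fracSymbol_mul_fracDensity hα0 hp, ← I_mul_fracDensity hp]
        simp [fracDensity, he]
        ring
      · simp only [hF', ← fracSymbol_mul_fracDensity hα0 hp, ← I_mul_fracDensity hp]
        simp [fracDensity, he]
        ring)
  have h2 := main.const_mul (1 / (2 * (Real.pi : ℂ)))
  refine h2.congr_fderiv ?_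
  have i1 := integrable_fracDensity_mul_exp hα0 hα1 (p := p + (α + 1)) (by linarith) hq q.2
  have i2 := integrable_fracDensity_mul_exp hα0 hα1 (p := p + 1) (by linarith) hq q.2
  have e1 := ((ContinuousLinearMap.smulRightL ℝ (ℝ × ℝ) ℂ
        (ContinuousLinearMap.fst ℝ ℝ ℝ)).integral_comp_comm i1)
  have e2 := ((ContinuousLinearMap.smulRightL ℝ (ℝ × ℝ) ℂ
        (ContinuousLinearMap.snd ℝ ℝ ℝ)).integral_comp_comm i2)
  have j1 := (ContinuousLinearMap.smulRightL ℝ (ℝ × ℝ) ℂ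
        (ContinuousLinearMap.fst ℝ ℝ ℝ)).integrable_comp i1
  have j2 := (ContinuousLinearMap.smulRightL ℝ (ℝ × ℝ) ℂ
        (ContinuousLinearMap.snd ℝ ℝ ℝ)).integrable_comp i2
  have e3 := integral_add j1 j2
  simp only [ContinuousLinearMap.smulRightL_apply_apply] at e1 e2 e3
  simp only [hF', he]
  rw [e3, e1, e2]
  ext <;> simp [fracMoment, invFourierLine]

theorem hasDerivAt_fracMoment_right {α : ℝ} (hα0 : 0 < α) (hα1 : α < 1) {p t : ℝ} (hp : -1 < p)
    (ht : 0 < t) (x : ℝ) : HasDerivAt (fracMoment α p t) (fracMoment α (p + 1) t x) x := by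
  have h := (hasFDerivAt_fracMoment hα0 hα1 hp (q := (t, x)) ht).comp_hasDerivAt x
    ((hasDerivAt_const x t).prodMk (hasDerivAt_id x))
  exact h.congr_deriv (by simp)

theorem hasDerivAt_fracMoment_left {α : ℝ} (hα0 : 0 < α) (hα1 : α < 1) {p t : ℝ} (hp : -1 < p)
    (ht : 0 < t) (x : ℝ) :
    HasDerivAt (fun s => fracMoment α p s x) (fracMoment α (p + (α + 1)) t x) t := by
  have h := (hasFDerivAt_fracMoment hα0 hα1 hp (q := (t, x)) ht).comp_hasDerivAt t
    ((hasDerivAt_id t).prodMk (hasDerivAt_const t x))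
  exact h.congr_deriv (by simp)

theorem continuous_fracMoment {α : ℝ} (hα0 : 0 < α) (hα1 : α < 1) {p t : ℝ} (hp : -1 < p)
    (ht : 0 < t) : Continuous (fracMoment α p t) :=
  continuous_iff_continuousAt.2 fun x =>
    (hasDerivAt_fracMoment_right hα0 hα1 hp ht x).continuousAt

theorem iteratedDeriv_fracKernel_right {α : ℝ} (hα0 : 0 < α) (hα1 : α < 1) {t : ℝ}
    (ht : 0 < t) (m : ℕ) :
    iteratedDeriv m (fun y : ℝ => fracKernel α t y) = fracMoment α m t := by
  induction m with
  | zero => ext x; simp [fracMoment_zero]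
  | succ m ih =>
    rw [iteratedDeriv_succ, ih]
    ext x
    have hm : (-1 : ℝ) < m := lt_of_lt_of_le (by norm_num) m.cast_nonneg
    rw [(hasDerivAt_fracMoment_right hα0 hα1 hm ht x).deriv, Nat.cast_succ]

theorem iteratedDeriv_fracKernel_left {α : ℝ} (hα0 : 0 < α) (hα1 : α < 1) (x : ℝ) (m : ℕ)
    {t : ℝ} (ht : 0 < t) :
    iteratedDeriv m (fun s : ℝ => fracKernel α s x) t = fracMoment α (m * (α + 1)) t x := by
  induction m generalizing t with
  | zero => simp [fracMoment_zero]
  | succ m ih =>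
    have hm : (-1 : ℝ) < m * (α + 1) := lt_of_lt_of_le neg_one_lt_zero (by positivity)
    have he : iteratedDeriv m (fun s : ℝ => fracKernel α s x) =ᶠ[nhds t]
        fun s => fracMoment α (m * (α + 1)) s x := by
      filter_upwards [lt_mem_nhds ht] with s hs using ih hs
    rw [iteratedDeriv_succ, he.deriv_eq, (hasDerivAt_fracMoment_left hα0 hα1 hm ht x).deriv]
    push_cast
    congr 1
    ring

/-- Both partial derivatives are again members of the family, so the induction runs over all p > -1
at once. -/
theorem contDiffOn_fracMoment {α : ℝ} (hα0 : 0 < α) (hα1 : α < 1) (n : ℕ) {p : ℝ} (hp : -1 < p) :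
    ContDiffOn ℝ n (fun q : ℝ × ℝ => fracMoment α p q.1 q.2) (Ioi (0 : ℝ) ×ˢ (univ : Set ℝ)) := by
  have ho : IsOpen (Ioi (0 : ℝ) ×ˢ (univ : Set ℝ)) := isOpen_Ioi.prod isOpen_univ
  induction n generalizing p with
  | zero =>
    refine contDiffOn_zero.2 fun q hq => ?_
    exact (hasFDerivAt_fracMoment hα0 hα1 hp hq.1).continuousAt.continuousWithinAt
  | succ n ih =>
    rw [Nat.cast_succ, contDiffOn_succ_iff_fderiv_of_isOpen ho]
    refine ⟨fun q hq => (hasFDerivAt_fracMoment hα0 hα1 hp hq.1).differentiableAt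
      |>.differentiableWithinAt, by simp, ?_⟩
    refine ContDiffOn.congr ?_ fun q hq => (hasFDerivAt_fracMoment hα0 hα1 hp hq.1).fderiv
    exact (contDiffOn_const.smulRight (ih (by linarith))).add
      (contDiffOn_const.smulRight (ih (by linarith)))

/-! ### Scaling -/

theorem ofReal_mul_cpow {r : ℝ} (hr : 0 < r) (z : ℂ) (q : ℝ) :
    ((r : ℂ) * z) ^ (q : ℂ) = ((r ^ q : ℝ) : ℂ) * z ^ (q : ℂ) := by
  have hr' : (r : ℂ) ≠ 0 := by exact_mod_cast hr.ne'
  rw [Complex.ofReal_cpow hr.le]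
  by_cases hz : z = 0
  · rw [hz, mul_zero]
    by_cases hq : (q : ℂ) = 0
    · simp [hq]
    · simp [Complex.zero_cpow hq]
  · rw [Complex.cpow_def_of_ne_zero (mul_ne_zero hr' hz), Complex.cpow_def_of_ne_zero hr',
      Complex.cpow_def_of_ne_zero hz, Complex.log_ofReal_mul hr hz, Complex.ofReal_log hr.le,
      ← Complex.exp_add]
    congr 1; ring

/-- Substitute rξ for ξ with r = t^(1/(1+α)): then r^(α+1) = t moves the time into the symbol, r^p
comes from the power and r from the measure. -/
theorem fracMoment_scaling {α : ℝ} (hα0 : 0 < α) (p : ℝ) {t : ℝ} (ht : 0 < t) (x : ℝ) :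
    fracMoment α p t x =
      ((1 / t ^ ((p + 1) / (1 + α)) : ℝ) : ℂ) * fracMoment α p 1 (x / t ^ (1 / (1 + α))) := by
  set r : ℝ := t ^ (1 / (1 + α)) with hr
  have hr0 : 0 < r := Real.rpow_pos_of_pos ht _
  have hra : r ^ (α + 1) = t := by
    rw [hr, ← Real.rpow_mul ht.le, add_comm α 1, one_div_mul_cancel (by linarith), Real.rpow_one]
  have hrp : t ^ ((p + 1) / (1 + α)) = r ^ p * r := by
    rw [hr, ← Real.rpow_add_one hr0.ne', ← Real.rpow_mul ht.le]
    congr 1; ring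
  have hcp : ∀ (q ξ : ℝ), (Complex.I * ((r * ξ : ℝ) : ℂ)) ^ (q : ℂ) =
      ((r ^ q : ℝ) : ℂ) * (Complex.I * (ξ : ℂ)) ^ (q : ℂ) := by
    intro q ξ
    rw [Complex.ofReal_mul, mul_left_comm, ofReal_mul_cpow hr0]
  have hd : ∀ ξ : ℝ, fracDensity α p 1 (r * ξ) * Complex.exp (Complex.I * ((r * ξ : ℝ) : ℂ) *
      ((x / r : ℝ) : ℂ)) = ((r ^ p : ℝ) : ℂ) * (fracDensity α p t ξ *
        Complex.exp (Complex.I * (ξ : ℂ) * (x : ℂ))) := by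
    intro ξ
    have h1 := hcp (α + 1) ξ
    rw [hra, Complex.ofReal_add, Complex.ofReal_one] at h1
    have h2 : Complex.I * ((r * ξ : ℝ) : ℂ) * ((x / r : ℝ) : ℂ) = Complex.I * (ξ : ℂ) * (x : ℂ) := by
      have : (r : ℂ) ≠ 0 := by exact_mod_cast hr0.ne'
      push_cast; field_simp
    unfold fracDensity fracSymbol
    rw [h2, h1, hcp p ξ, Complex.ofReal_one, mul_one, mul_comm (t : ℂ)]
    ring
  have hsub := Measure.integral_comp_mul_left (fun ξ : ℝ => fracDensity α p 1 ξ *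
    Complex.exp (Complex.I * (ξ : ℂ) * ((x / r : ℝ) : ℂ))) r
  simp only [hd] at hsub
  rw [integral_const_mul, abs_of_pos (inv_pos.2 hr0)] at hsub
  unfold fracMoment invFourierLine
  have hrp0 : ((r ^ p : ℝ) : ℂ) ≠ 0 := by exact_mod_cast (Real.rpow_pos_of_pos hr0 p).ne'
  rw [Complex.real_smul] at hsub
  rw [hrp, ← mul_right_inj' hrp0]
  have hc : ((r ^ p : ℝ) : ℂ) * ((1 / (r ^ p * r) : ℝ) : ℂ) = ((r⁻¹ : ℝ) : ℂ) := by
    rw [← Complex.ofReal_mul]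
    congr 1
    have := (Real.rpow_pos_of_pos hr0 p).ne'
    field_simp
  linear_combination (1 / (2 * (Real.pi : ℂ))) * hsub - (1 / (2 * (Real.pi : ℂ)) *
    ∫ y : ℝ, fracDensity α p 1 y * Complex.exp (Complex.I * ↑y * ↑(x / r))) * hc

/-! ### Decay in space by integration by parts -/

/-- The point `a` is excepted because powers of iξ need not be differentiable at 0. The boundary
values at `a` from the two half-lines cancel by continuity. -/
theorem integral_eq_zero_of_hasDerivAt_of_ne {f f' : ℝ → ℂ} (a : ℝ) (hc : Continuous f)
    (hd : ∀ x ≠ a, HasDerivAt f (f' x) x) (hf : Integrable f) (hf' : Integrable f') :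
    ∫ x, f' x = 0 := by
  have ht := tendsto_zero_of_hasDerivAt_of_integrableOn_Ioi (a := a)
    (fun x hx => hd x (ne_of_gt hx)) hf'.integrableOn hf.integrableOn
  have hb : Filter.Tendsto f Filter.atBot (nhds 0) := tendsto_zero_of_hasDerivAt_of_integrableOn_Iic
    (a := a - 1) (fun x hx => hd x (by simp at hx; linarith)) hf'.integrableOn hf.integrableOn
  rw [← intervalIntegral.integral_Iic_add_Ioi (b := a) hf'.integrableOn hf'.integrableOn,
    integral_Ioi_of_hasDerivAt_of_tendsto hc.continuousWithinAt (fun x hx => hd x (ne_of_gt hx))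
      hf'.integrableOn ht,
    integral_Iic_of_hasDerivAt_of_tendsto hc.continuousWithinAt (fun x hx => hd x (ne_of_lt hx))
      hf'.integrableOn hb]
  ring

theorem hasDerivAt_fracDensity {α : ℝ} (p t : ℝ) {ξ : ℝ} (hξ : ξ ≠ 0) :
    HasDerivAt (fracDensity α p t)
      (Complex.I * (p * fracDensity α (p - 1) t ξ + t * (α + 1) * fracDensity α (p + α) t ξ)) ξ := by
  have hs : Complex.I * (ξ : ℂ) ∈ Complex.slitPlane := by simp [Complex.mem_slitPlane_iff, hξ]
  have hs0 : Complex.I * (ξ : ℂ) ≠ 0 := by simp [hξ]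
  have h0 : HasDerivAt (fun ξ : ℝ => Complex.I * (ξ : ℂ)) Complex.I ξ := by
    simpa using (hasDerivAt_id ξ).ofReal_comp.const_mul Complex.I
  have hpow : ∀ c : ℂ, HasDerivAt (fun ξ : ℝ => (Complex.I * (ξ : ℂ)) ^ c)
      (c * (Complex.I * (ξ : ℂ)) ^ (c - 1) * Complex.I) ξ := fun c =>
    ((hasStrictDerivAt_id (Complex.I * (ξ : ℂ))).cpow_const hs).hasDerivAt.comp_of_eq ξ h0 rfl
      |>.congr_deriv (by simp)
  have h1 := hpow p
  have h2 := hpow ((α : ℂ) + 1)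
  refine (h1.mul (h2.mul_const (t : ℂ)).cexp).congr_deriv ?_
  unfold fracDensity fracSymbol
  rw [Complex.ofReal_sub, Complex.ofReal_add, Complex.ofReal_one,
    add_sub_cancel_right, Complex.cpow_add (x := Complex.I * (ξ : ℂ)) (p : ℂ) (α : ℂ) hs0]
  ring

theorem mul_fracMoment {α : ℝ} (hα0 : 0 < α) (hα1 : α < 1) {p t : ℝ} (hp : 0 ≤ p)
    (ht : 0 < t) (x : ℝ) :
    x * fracMoment α p t x =
      -(p * fracMoment α (p - 1) t x + t * (α + 1) * fracMoment α (p + α) t x) := by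
  set e : ℝ → ℂ := fun ξ => Complex.exp (Complex.I * (ξ : ℂ) * (x : ℂ)) with he
  have i1 : Integrable fun ξ => (p : ℂ) * (fracDensity α (p - 1) t ξ * e ξ) := by
    -- At p = 0 the density with exponent -1 need not be integrable, but its coefficient vanishes.
    rcases hp.eq_or_lt with rfl | hp
    · simp
    · exact (integrable_fracDensity_mul_exp hα0 hα1 (by linarith) ht x).const_mul _
  have i2 : Integrable fun ξ => (t * (α + 1) : ℂ) * (fracDensity α (p + α) t ξ * e ξ) :=
    (integrable_fracDensity_mul_exp hα0 hα1 (by linarith) ht x).const_mul _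
  have i3 : Integrable fun ξ => fracDensity α p t ξ * e ξ :=
    integrable_fracDensity_mul_exp hα0 hα1 (by linarith) ht x
  have i4 := i3.const_mul (x : ℂ)
  have key := integral_eq_zero_of_hasDerivAt_of_ne (f := fun ξ => fracDensity α p t ξ * e ξ)
    (f' := fun ξ => Complex.I * ((p : ℂ) * (fracDensity α (p - 1) t ξ * e ξ) +
      (t * (α + 1) : ℂ) * (fracDensity α (p + α) t ξ * e ξ) + x * (fracDensity α p t ξ * e ξ))) 0
    (by have := continuous_fracDensity hα0 hp t; fun_prop)
    (fun ξ hξ => by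
      have h0 : HasDerivAt (fun ξ : ℝ => Complex.I * (ξ : ℂ) * (x : ℂ)) (Complex.I * x) ξ := by
        simpa using ((hasDerivAt_id ξ).ofReal_comp.const_mul Complex.I).mul_const (x : ℂ)
      refine ((hasDerivAt_fracDensity p t hξ).mul h0.cexp).congr_deriv ?_
      simp only [he]; ring)
    i3 (((i1.add i2).add i4).const_mul _)
  have key2 := integral_add (i1.add i2) i4
  have key3 := integral_add i1 i2
  simp only [Pi.add_apply] at key2 key3
  rw [integral_const_mul, key2, key3] at key
  simp only [integral_const_mul, mul_eq_zero, Complex.I_ne_zero, false_or] at key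
  unfold fracMoment invFourierLine
  linear_combination (1 / (2 * (Real.pi : ℂ))) * key

theorem norm_fracMoment_le (α p t x : ℝ) :
    ‖fracMoment α p t x‖ ≤ ‖(1 / (2 * (Real.pi : ℂ)))‖ * ∫ ξ, ‖fracDensity α p t ξ‖ := by
  rw [fracMoment, invFourierLine, norm_mul]
  gcongr
  refine (norm_integral_le_integral_norm _).trans_eq ?_
  simp only [norm_mul, norm_exp_I_mul_mul, mul_one]

/-- One integration by parts buys one power of |x|. The factor p stays inside the first hypothesis
so that it holds trivially at p = 0. -/
theorem pow_mul_norm_fracMoment_le {α : ℝ} (hα0 : 0 < α) (hα1 : α < 1) {n : ℕ} {p C₁ C₂ : ℝ}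
    (hp : 0 ≤ p) (h₁ : ∀ x : ℝ, p * (|x| ^ n * ‖fracMoment α (p - 1) 1 x‖) ≤ C₁)
    (h₂ : ∀ x : ℝ, |x| ^ n * ‖fracMoment α (p + α) 1 x‖ ≤ C₂) (x : ℝ) :
    |x| ^ (n + 1) * ‖fracMoment α p 1 x‖ ≤ C₁ + (α + 1) * C₂ := by
  have e : |x| ^ (n + 1) * ‖fracMoment α p 1 x‖ = |x| ^ n * ‖(x : ℂ) * fracMoment α p 1 x‖ := by
    rw [norm_mul, Complex.norm_real, Real.norm_eq_abs]; ring
  rw [e, mul_fracMoment hα0 hα1 hp one_pos, norm_neg]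
  have h3 : ‖(p : ℂ) * fracMoment α (p - 1) 1 x +
      (1 : ℝ) * (α + 1) * fracMoment α (p + α) 1 x‖ ≤
      p * ‖fracMoment α (p - 1) 1 x‖ + (α + 1) * ‖fracMoment α (p + α) 1 x‖ := by
    refine (norm_add_le _ _).trans_eq ?_
    rw [norm_mul, norm_mul, Complex.norm_real, Real.norm_of_nonneg hp, Complex.ofReal_one,
      one_mul, ← Complex.ofReal_one, ← Complex.ofReal_add, Complex.norm_real,
      Real.norm_of_nonneg (by linarith)]
  calc _ ≤ |x| ^ n * _ := mul_le_mul_of_nonneg_left h3 (by positivity)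
    _ = p * (|x| ^ n * ‖fracMoment α (p - 1) 1 x‖) +
        (α + 1) * (|x| ^ n * ‖fracMoment α (p + α) 1 x‖) := by ring
    _ ≤ _ := add_le_add (h₁ x) (mul_le_mul_of_nonneg_left (h₂ x) (by linarith))

/-- Each power of |x| lowers the exponent by at most 1, and it must end above -1; hence n - 1 < p.
-/
theorem exists_pow_mul_norm_fracMoment_le {α : ℝ} (hα0 : 0 < α) (hα1 : α < 1) (n : ℕ) {p : ℝ}
    (hp : (n : ℝ) - 1 < p) : ∃ C : ℝ, ∀ x : ℝ, |x| ^ n * ‖fracMoment α p 1 x‖ ≤ C := by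
  induction n generalizing p with
  | zero =>
    exact ⟨_, fun x => by simpa using norm_fracMoment_le α p 1 x⟩
  | succ n ih =>
    push_cast at hp
    obtain ⟨C₁, h₁⟩ := ih (p := p - 1) (by linarith)
    obtain ⟨C₂, h₂⟩ := ih (p := p + α) (by linarith)
    have hp0 : 0 ≤ p := by have : (0 : ℝ) ≤ n := n.cast_nonneg; linarith
    exact ⟨p * C₁ + (α + 1) * C₂, pow_mul_norm_fracMoment_le hα0 hα1 hp0
      (fun x => mul_le_mul_of_nonneg_left (h₁ x) hp0) h₂⟩

/-- For integer exponents the descent p, p - 1, ... reaches 0, where its next term has coefficient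
0, so it never leaves the admissible range. Only the terms in p + α remain, and α > 0 is just enough
for them to satisfy the general bound with power m + 1. This gives m + 2, beyond the general result.
-/
theorem exists_pow_mul_norm_fracMoment_natCast_le {α : ℝ} (hα0 : 0 < α) (hα1 : α < 1) (m : ℕ) :
    ∃ C : ℝ, ∀ x : ℝ, |x| ^ (m + 2) * ‖fracMoment α m 1 x‖ ≤ C := by
  induction m with
  | zero =>
    obtain ⟨C₂, h₂⟩ := exists_pow_mul_norm_fracMoment_le hα0 hα1 1 (p := 0 + α)
      (by simpa using hα0)
    refine ⟨0 + (α + 1) * C₂, ?_⟩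
    rw [Nat.cast_zero]
    exact pow_mul_norm_fracMoment_le hα0 hα1 le_rfl (fun x => by simp) h₂
  | succ m ih =>
    obtain ⟨C₁, h₁⟩ := ih
    obtain ⟨C₂, h₂⟩ := exists_pow_mul_norm_fracMoment_le hα0 hα1 (m + 2)
      (p := ((m + 1 : ℕ) : ℝ) + α) (by push_cast; linarith)
    refine ⟨((m + 1 : ℕ) : ℝ) * C₁ + (α + 1) * C₂, pow_mul_norm_fracMoment_le hα0 hα1
      (Nat.cast_nonneg _) (fun x => mul_le_mul_of_nonneg_left ?_ (Nat.cast_nonneg _)) h₂⟩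
    rw [Nat.cast_succ, add_sub_cancel_right]
    exact h₁ x

theorem exists_norm_fracMoment_le_div {α p : ℝ} (hα0 : 0 < α) (hα1 : α < 1) (hp : -1 < p) {n : ℕ}
    (h : ∃ C : ℝ, ∀ x : ℝ, |x| ^ n * ‖fracMoment α p 1 x‖ ≤ C) :
    ∃ B : ℝ, 0 < B ∧ ∀ x : ℝ, ‖fracMoment α p 1 x‖ ≤ B / (1 + |x| ^ n) := by
  obtain ⟨C₀, h₀⟩ := exists_pow_mul_norm_fracMoment_le hα0 hα1 0 (p := p) (by simpa using hp)
  obtain ⟨C, hC⟩ := h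
  have p0 : 0 ≤ C₀ := le_trans (by positivity) (h₀ 0)
  have p1 : 0 ≤ C := le_trans (by positivity) (hC 0)
  refine ⟨C₀ + C + 1, by positivity, fun x => ?_⟩
  rw [le_div_iff₀ (by positivity)]
  have a := h₀ x
  have b := hC x
  rw [pow_zero, one_mul] at a
  linarith

theorem exists_norm_fracMoment_natCast_le_div {α : ℝ} (hα0 : 0 < α) (hα1 : α < 1) (m : ℕ) :
    ∃ B : ℝ, 0 < B ∧ ∀ x : ℝ, ‖fracMoment α m 1 x‖ ≤ B / (1 + |x| ^ (m + 2)) :=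
  exists_norm_fracMoment_le_div hα0 hα1 (neg_one_lt_zero.trans_le m.cast_nonneg)
    (exists_pow_mul_norm_fracMoment_natCast_le hα0 hα1 m)

theorem exists_norm_fracMoment_natCast_mul_le_div {α : ℝ} (hα0 : 0 < α) (hα1 : α < 1) (m : ℕ) :
    ∃ B : ℝ, 0 < B ∧ ∀ x : ℝ, ‖fracMoment α (m * (α + 1)) 1 x‖ ≤ B / (1 + |x| ^ 2) := by
  rcases m.eq_zero_or_pos with rfl | hm
  · simpa using exists_norm_fracMoment_natCast_le_div hα0 hα1 0
  -- For m ≥ 1 the exponent m(α+1) exceeds 1, which is what two powers of |x| require.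
  · have : (1 : ℝ) ≤ m := by exact_mod_cast hm
    exact exists_norm_fracMoment_le_div hα0 hα1 (by nlinarith)
      (exists_pow_mul_norm_fracMoment_le hα0 hα1 2 (by push_cast; nlinarith))

theorem integrable_of_norm_le_div {f : ℝ → ℂ} (hf : Continuous f) {B : ℝ} {n : ℕ} (hn : 2 ≤ n)
    (h : ∀ x : ℝ, ‖f x‖ ≤ B / (1 + |x| ^ n)) : Integrable f := by
  have hB : 0 ≤ B := by
    have := (norm_nonneg _).trans (h 0)
    rw [abs_zero, zero_pow (by omega), add_zero, div_one] at this
    exact this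
  refine (integrable_inv_one_add_sq.const_mul (2 * B)).mono' hf.aestronglyMeasurable
    (ae_of_all _ fun x => (h x).trans ?_)
  rw [← div_eq_mul_inv, div_le_div_iff₀ (by positivity) (by positivity)]
  have h2 : 1 + x ^ 2 ≤ 2 * (1 + |x| ^ n) := by
    rw [← sq_abs]
    rcases le_total |x| 1 with h1 | h1
    · have : |x| ^ 2 ≤ 1 := pow_le_one₀ (abs_nonneg x) h1
      have : 0 ≤ |x| ^ n := by positivity
      linarith
    · have := pow_le_pow_right₀ h1 hn
      have : 0 ≤ |x| ^ n := by positivity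
      linarith
  nlinarith

/-! ### Fourier inversion and L¹ norms -/

open scoped FourierTransform in
theorem fourier_fracDensity (α p t w : ℝ) :
    𝓕 (fracDensity α p t) w = 2 * (Real.pi : ℂ) * fracMoment α p t (-(2 * Real.pi) * w) := by
  have hpi : (Real.pi : ℂ) ≠ 0 := by exact_mod_cast Real.pi_ne_zero
  rw [Real.fourier_real_eq_integral_exp_smul, fracMoment, invFourierLine, ← mul_assoc,
    mul_one_div_cancel (by simp), one_mul]
  congr 1
  ext ξ
  rw [smul_eq_mul, mul_comm]
  congr 2
  push_cast; ring

-- Fourier inversion applies since the density is continuous and integrable and its transform is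
-- integrable. The factors 2π reconcile the kernel e^{-2πiξw} of `𝓕` with e^{-iξx}.
open scoped FourierTransform in
theorem integral_fracMoment_mul_exp {α : ℝ} (hα0 : 0 < α) (hα1 : α < 1) {p t : ℝ} (hp : 0 ≤ p)
    (ht : 0 < t) (hi : Integrable (fracMoment α p t)) (ξ : ℝ) :
    ∫ x : ℝ, fracMoment α p t x * Complex.exp (-(Complex.I * (ξ : ℂ) * (x : ℂ))) =
      fracDensity α p t ξ := by
  have h2pi : -(2 * Real.pi) ≠ 0 := by simp
  have hF : 𝓕 (fracDensity α p t) =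
      fun w => 2 * (Real.pi : ℂ) * fracMoment α p t (-(2 * Real.pi) * w) := by
    ext w; exact fourier_fracDensity α p t w
  have inv := congrFun ((continuous_fracDensity hα0 hp t).fourierInv_fourier_eq
    (integrable_fracDensity hα0 hα1 (by linarith) ht) (by
      rw [hF]; exact ((integrable_comp_mul_left_iff _ h2pi).2 hi).const_mul _)) ξ
  rw [← inv, Real.fourierInv_eq_fourier_neg, Real.fourier_real_eq_integral_exp_smul, hF]
  have hs := Measure.integral_comp_mul_left (fun x : ℝ => fracMoment α p t x *
    Complex.exp (-(Complex.I * (ξ : ℂ) * (x : ℂ)))) (-(2 * Real.pi))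
  have ha : |(-(2 * Real.pi))⁻¹| = (2 * Real.pi)⁻¹ := by
    rw [inv_neg, abs_neg, abs_of_pos (by positivity)]
  rw [ha, eq_inv_smul_iff₀ (by positivity), ← integral_smul] at hs
  rw [← hs]
  congr 1
  ext w
  rw [smul_eq_mul, Complex.real_smul]
  push_cast
  rw [show -2 * (Real.pi : ℂ) * w * -ξ * Complex.I = -(Complex.I * ξ * (-(2 * Real.pi) * w)) by ring]
  ring

theorem integrable_fracMoment_of_one {α : ℝ} (hα0 : 0 < α) {p t : ℝ} (ht : 0 < t)
    (hi : Integrable (fracMoment α p 1)) : Integrable (fracMoment α p t) := by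
  have h : fracMoment α p t = fun x => _ := funext (fracMoment_scaling hα0 p ht)
  rw [h]
  exact (hi.comp_div (Real.rpow_pos_of_pos ht _).ne').const_mul _

theorem integral_norm_fracMoment {α : ℝ} (hα0 : 0 < α) {p t : ℝ} (ht : 0 < t) :
    ∫ x, ‖fracMoment α p t x‖ = (∫ x, ‖fracMoment α p 1 x‖) / t ^ (p / (1 + α)) := by
  have hr := Real.rpow_pos_of_pos ht (1 / (1 + α))
  simp_rw [fracMoment_scaling hα0 p ht, norm_mul, Complex.norm_real]
  rw [integral_const_mul, Measure.integral_comp_div (fun x => ‖fracMoment α p 1 x‖),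
    abs_of_pos hr, Real.norm_of_nonneg (by positivity), smul_eq_mul, add_div, Real.rpow_add ht]
  field_simp

/-- If the norm vanished, so would the Fourier transform, which is an exponential in modulus at ξ =
1. -/
theorem integral_norm_fracMoment_pos {α : ℝ} (hα0 : 0 < α) (hα1 : α < 1) {p t : ℝ} (hp : 0 ≤ p)
    (ht : 0 < t) (hi : Integrable (fracMoment α p t)) : 0 < ∫ x, ‖fracMoment α p t x‖ := by
  refine lt_of_le_of_ne (integral_nonneg fun _ => norm_nonneg _) fun h0 => ?_
  have h1 := (integral_eq_zero_iff_of_nonneg (fun _ => norm_nonneg _) hi.norm).1 h0.symm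
  have h2 := integral_fracMoment_mul_exp hα0 hα1 hp ht hi 1
  rw [integral_eq_zero_of_ae (by
    filter_upwards [h1] with x hx
    simp only [Pi.zero_apply, norm_eq_zero] at hx
    simp [hx])] at h2
  have h3 := norm_fracDensity hα0 p t 1
  rw [← h2] at h3
  simp only [norm_zero, abs_one, Real.one_rpow, one_mul, mul_one] at h3
  exact (Real.exp_pos _).ne h3

theorem integrable_fracMoment_natCast {α : ℝ} (hα0 : 0 < α) (hα1 : α < 1) (m : ℕ) {t : ℝ}
    (ht : 0 < t) : Integrable (fracMoment α m t) := by
  obtain ⟨B, -, h⟩ := exists_norm_fracMoment_natCast_le_div hα0 hα1 m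
  exact integrable_fracMoment_of_one hα0 ht (integrable_of_norm_le_div
    (continuous_fracMoment hα0 hα1 (neg_one_lt_zero.trans_le m.cast_nonneg) one_pos) (by omega) h)

theorem integrable_fracMoment_natCast_mul {α : ℝ} (hα0 : 0 < α) (hα1 : α < 1) (m : ℕ) {t : ℝ}
    (ht : 0 < t) : Integrable (fracMoment α (m * (α + 1)) t) := by
  obtain ⟨B, -, h⟩ := exists_norm_fracMoment_natCast_mul_le_div hα0 hα1 m
  exact integrable_fracMoment_of_one hα0 ht (integrable_of_norm_le_div
    (continuous_fracMoment hα0 hα1 (neg_one_lt_zero.trans_le (by positivity)) one_pos) le_rfl h)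

/-! ### Semigroup property -/

theorem fracDensity_add {α : ℝ} (p a b ξ : ℝ) :
    fracDensity α 0 a ξ * fracDensity α p b ξ = fracDensity α p (a + b) ξ := by
  unfold fracDensity
  rw [Complex.ofReal_zero, Complex.cpow_zero, one_mul, mul_left_comm, ← Complex.exp_add,
    Complex.ofReal_add, mul_add]

/-- Write the second factor as its inverse Fourier integral and apply Fubini: the inner integral is
the transform of the first factor. Only the first factor has to be integrable; the second is
bounded. -/
theorem convolution_fracMoment {α : ℝ} (hα0 : 0 < α) (hα1 : α < 1) {p a b : ℝ} (hp : 0 ≤ p)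
    (ha : 0 < a) (hb : 0 < b) :
    ConvolutionExists (fracMoment α 0 a) (fracMoment α p b) (ContinuousLinearMap.mul ℝ ℂ) volume ∧
      fracMoment α 0 a ⋆[ContinuousLinearMap.mul ℝ ℂ, volume] fracMoment α p b =
        fracMoment α p (a + b) := by
  have hf : Integrable (fracMoment α 0 a) := by
    simpa using integrable_fracMoment_natCast hα0 hα1 0 ha
  have hg := integrable_fracDensity hα0 hα1 (p := p) (by linarith) hb
  have hgm := measurable_fracDensity α p b
  have hfm := (continuous_fracMoment hα0 hα1 (p := 0) (by norm_num) ha).measurable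
  have hgc := continuous_fracMoment hα0 hα1 (p := p) (by linarith) hb
  refine ⟨fun x => ?_, ?_⟩
  · exact hf.mul_bdd (by fun_prop) (ae_of_all _ fun y => norm_fracMoment_le α p b (x - y))
  · ext x
    rw [convolution_def]
    have hprod : Integrable (Function.uncurry fun y ξ : ℝ => fracMoment α 0 a y *
        (fracDensity α p b ξ * Complex.exp (Complex.I * (ξ : ℂ) * ((x - y : ℝ) : ℂ))))
        (volume.prod volume) := by
      refine (hf.mul_prod hg).norm.mono' ?_ (ae_of_all _ fun z => ?_)
      · apply Measurable.aestronglyMeasurable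
        unfold Function.uncurry
        fun_prop
      · simp only [Function.uncurry, norm_mul, norm_exp_I_mul_mul, mul_one, le_refl]
    have hswap := integral_integral_swap hprod
    simp only [integral_const_mul] at hswap
    have hL : ∀ y, (ContinuousLinearMap.mul ℝ ℂ) (fracMoment α 0 a y)
        (fracMoment α p b (x - y)) = (1 / (2 * (Real.pi : ℂ))) * (fracMoment α 0 a y *
          ∫ ξ, fracDensity α p b ξ * Complex.exp (Complex.I * (ξ : ℂ) * ((x - y : ℝ) : ℂ))) := by
      intro y
      simp only [ContinuousLinearMap.mul_apply']
      rw [mul_left_comm]; rfl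
    simp_rw [hL]
    rw [integral_const_mul, hswap]
    change _ = invFourierLine _ _
    rw [invFourierLine]
    congr 2
    ext ξ
    rw [← fracDensity_add, ← integral_fracMoment_mul_exp hα0 hα1 le_rfl ha hf ξ, mul_assoc,
      ← integral_mul_const]
    congr 1
    ext y
    push_cast
    rw [show Complex.I * (ξ : ℂ) * ((x : ℂ) - y) = Complex.I * ξ * x + -(Complex.I * ξ * y) by ring,
      Complex.exp_add]
    ring

/-! ### Functions whose multiplication preserves positivity -/

section

open scoped ComplexOrder

/-- A bounded measurable function all of whose Gaussian regularised inverse Fourier transforms are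
non-negative. -/
structure HasNonnegGaussianTransform (f : ℝ → ℂ) : Prop where
  measurable : Measurable f
  bounded : ∃ C : ℝ, ∀ ξ, ‖f ξ‖ ≤ C
  nonneg : ∀ x ε : ℝ, 0 < ε →
    0 ≤ ∫ ξ : ℝ, f ξ * (Complex.exp (Complex.I * (x : ℂ) * (ξ : ℂ)) *
      Complex.exp (-(ε : ℂ) * (ξ : ℂ) ^ 2))

/-- The functions bounded by their value at `0` that multiply `HasNonnegGaussianTransform` into
itself. Positive combinations of characters have this property. -/
structure IsPositiveMultiplier (g : ℝ → ℂ) : Prop where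
  measurable : Measurable g
  norm_le : ∀ ξ, ‖g ξ‖ ≤ (g 0).re
  mul : ∀ f, HasNonnegGaussianTransform f → HasNonnegGaussianTransform fun ξ => g ξ * f ξ

theorem norm_exp_mul_gaussian (x ε ξ : ℝ) :
    ‖Complex.exp (Complex.I * (x : ℂ) * (ξ : ℂ)) * Complex.exp (-(ε : ℂ) * (ξ : ℂ) ^ 2)‖ =
      Real.exp (-ε * ξ ^ 2) := by
  rw [norm_mul, norm_exp_I_mul_mul, one_mul, Complex.norm_exp]
  congr 1
  rw [← Complex.ofReal_pow, ← Complex.ofReal_neg, ← Complex.ofReal_mul, Complex.ofReal_re]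

theorem integrable_mul_exp_mul_gaussian {f : ℝ → ℂ} (hf : Measurable f) {C : ℝ}
    (hC : ∀ ξ, ‖f ξ‖ ≤ C) (x : ℝ) {ε : ℝ} (hε : 0 < ε) :
    Integrable fun ξ : ℝ => f ξ * (Complex.exp (Complex.I * (x : ℂ) * (ξ : ℂ)) *
      Complex.exp (-(ε : ℂ) * (ξ : ℂ) ^ 2)) := by
  refine ((integrable_exp_neg_mul_sq hε).const_mul C).mono' (by fun_prop)
    (ae_of_all _ fun ξ => ?_)
  rw [norm_mul, norm_exp_mul_gaussian]
  exact mul_le_mul_of_nonneg_right (hC ξ) (Real.exp_pos _).le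

theorem hasNonnegGaussianTransform_one : HasNonnegGaussianTransform fun _ => 1 where
  measurable := measurable_const
  bounded := ⟨1, fun _ => by simp⟩
  nonneg x ε hε := by
    have h := fourierIntegral_gaussian (b := (ε : ℂ)) (by simpa using hε) (x : ℂ)
    simp only [one_mul]
    rw [h]
    have e : ((Real.pi : ℂ) / ε) ^ (1 / 2 : ℂ) * Complex.exp (-(x : ℂ) ^ 2 / (4 * ε)) =
        (((Real.pi / ε) ^ (1 / 2 : ℝ) * Real.exp (-x ^ 2 / (4 * ε)) : ℝ) : ℂ) := by
      rw [Complex.ofReal_mul, Complex.ofReal_cpow (by positivity)]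
      push_cast
      rfl
    rw [e, Complex.zero_le_real]
    positivity

namespace IsPositiveMultiplier

theorem const {c : ℝ} (hc : 0 ≤ c) : IsPositiveMultiplier fun _ => (c : ℂ) where
  measurable := measurable_const
  norm_le ξ := by simp [abs_of_nonneg hc]
  mul f hf := by
    obtain ⟨C, hC⟩ := hf.bounded
    refine ⟨hf.measurable.const_mul _, ⟨c * C, fun ξ => ?_⟩, fun x ε hε => ?_⟩
    · rw [norm_mul, Complex.norm_real, Real.norm_of_nonneg hc]
      exact mul_le_mul_of_nonneg_left (hC ξ) hc
    · simp only [mul_assoc, integral_const_mul]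
      exact mul_nonneg (Complex.zero_le_real.2 hc) (by simpa [mul_assoc] using hf.nonneg x ε hε)

theorem character (l : ℝ) :
    IsPositiveMultiplier fun ξ => Complex.exp (Complex.I * (l : ℂ) * (ξ : ℂ)) where
  measurable := by fun_prop
  norm_le ξ := by rw [norm_exp_I_mul_mul]; simp
  mul f hf := by
    obtain ⟨C, hC⟩ := hf.bounded
    have hm := hf.measurable
    refine ⟨by fun_prop, ⟨C, fun ξ => ?_⟩, fun x ε hε => ?_⟩
    · rw [norm_mul, norm_exp_I_mul_mul, one_mul]
      exact hC ξ
    · convert hf.nonneg (x + l) ε hε using 3 with ξ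
      rw [Complex.ofReal_add, mul_add, add_mul, Complex.exp_add]
      ring

theorem add {g h : ℝ → ℂ} (hg : IsPositiveMultiplier g) (hh : IsPositiveMultiplier h) :
    IsPositiveMultiplier fun ξ => g ξ + h ξ where
  measurable := hg.measurable.add hh.measurable
  norm_le ξ := (norm_add_le _ _).trans (add_le_add (hg.norm_le ξ) (hh.norm_le ξ))
  mul f hf := by
    obtain ⟨m₁, ⟨C₁, b₁⟩, n₁⟩ := hg.mul f hf
    obtain ⟨m₂, ⟨C₂, b₂⟩, n₂⟩ := hh.mul f hf
    simp only [add_mul] at *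
    refine ⟨m₁.add m₂, ⟨C₁ + C₂, fun ξ => (norm_add_le _ _).trans (add_le_add (b₁ ξ) (b₂ ξ))⟩,
      fun x ε hε => ?_⟩
    simp only [add_mul]
    rw [integral_add (integrable_mul_exp_mul_gaussian m₁ b₁ x hε)
      (integrable_mul_exp_mul_gaussian m₂ b₂ x hε)]
    exact add_nonneg (n₁ x ε hε) (n₂ x ε hε)

/-- The bound at ξ = 0 forces |g 0| = Re (g 0). This makes the real part at 0 multiplicative, as
products require. -/
theorem apply_zero {g : ℝ → ℂ} (hg : IsPositiveMultiplier g) : (g 0).im = 0 := by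
  have h1 := hg.norm_le 0
  have h2 := Complex.sq_norm_sub_sq_re (g 0)
  have h4 := Complex.re_le_norm (g 0)
  have h5 : ‖g 0‖ = (g 0).re := le_antisymm h1 h4
  rw [h5, sub_self] at h2
  exact pow_eq_zero_iff (two_ne_zero) |>.1 h2.symm

theorem mul' {g h : ℝ → ℂ} (hg : IsPositiveMultiplier g) (hh : IsPositiveMultiplier h) :
    IsPositiveMultiplier fun ξ => g ξ * h ξ where
  measurable := hg.measurable.mul hh.measurable
  norm_le ξ := by
    rw [norm_mul, Complex.mul_re, hg.apply_zero, zero_mul, sub_zero]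
    exact mul_le_mul (hg.norm_le ξ) (hh.norm_le ξ) (norm_nonneg _)
      ((norm_nonneg _).trans (hg.norm_le ξ))
  mul f hf := by simpa only [mul_assoc] using hg.mul _ (hh.mul f hf)

theorem pow {g : ℝ → ℂ} (hg : IsPositiveMultiplier g) (n : ℕ) :
    IsPositiveMultiplier fun ξ => g ξ ^ n := by
  induction n with
  | zero => simpa using const zero_le_one
  | succ n ih => simpa only [pow_succ] using ih.mul' hg

theorem sum {g : ℕ → ℝ → ℂ} (hg : ∀ k, IsPositiveMultiplier (g k)) (n : ℕ) :
    IsPositiveMultiplier fun ξ => ∑ k ∈ Finset.range n, g k ξ := by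
  induction n with
  | zero => simpa using const le_rfl
  | succ n ih => simpa only [Finset.sum_range_succ] using ih.add (hg n)

/-- Convergence at 0 alone bounds the whole sequence uniformly, because every multiplier is
dominated by its value at 0. With the Gaussian factor this allows dominated convergence. -/
theorem of_tendsto {g : ℕ → ℝ → ℂ} {g' : ℝ → ℂ} (hg : ∀ n, IsPositiveMultiplier (g n))
    (h : ∀ ξ, Filter.Tendsto (fun n => g n ξ) Filter.atTop (nhds (g' ξ))) :
    IsPositiveMultiplier g' := by
  have hre := (Complex.continuous_re.tendsto _).comp (h 0)
  have hm : Measurable g' :=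
    measurable_of_tendsto_metrizable (fun n => (hg n).measurable) (tendsto_pi_nhds.2 h)
  have hle : ∀ ξ, ‖g' ξ‖ ≤ (g' 0).re := fun ξ =>
    le_of_tendsto_of_tendsto (h ξ).norm hre (Filter.Eventually.of_forall fun n => (hg n).norm_le ξ)
  refine ⟨hm, hle, fun f hf => ?_⟩
  obtain ⟨C, hC⟩ := hf.bounded
  have hC0 : 0 ≤ C := (norm_nonneg _).trans (hC 0)
  refine ⟨hm.mul hf.measurable, ⟨(g' 0).re * C, fun ξ => ?_⟩, fun x ε hε => ?_⟩
  · rw [norm_mul]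
    exact mul_le_mul (hle ξ) (hC ξ) (norm_nonneg _) ((norm_nonneg _).trans (hle ξ))
  · obtain ⟨B, hB⟩ := hre.bddAbove_range
    have hBn : ∀ n ξ, ‖g n ξ‖ ≤ B := fun n ξ =>
      ((hg n).norm_le ξ).trans (hB (mem_range_self n))
    refine ge_of_tendsto' (tendsto_integral_of_dominated_convergence
      (F := fun n ξ => g n ξ * f ξ * (Complex.exp (Complex.I * (x : ℂ) * (ξ : ℂ)) *
        Complex.exp (-(ε : ℂ) * (ξ : ℂ) ^ 2))) (fun ξ => B * C * Real.exp (-ε * ξ ^ 2))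
      (fun n => ?_) ((integrable_exp_neg_mul_sq hε).const_mul _) (fun n => ae_of_all _ fun ξ => ?_)
      (ae_of_all _ fun ξ => ((h ξ).mul_const _).mul_const _))
      fun n => ((hg n).mul f hf).nonneg x ε hε
    · have := (hg n).measurable
      have := hf.measurable
      fun_prop
    · rw [norm_mul, norm_mul, norm_exp_mul_gaussian]
      exact mul_le_mul_of_nonneg_right (mul_le_mul (hBn n ξ) (hC ξ) (norm_nonneg _)
        ((norm_nonneg _).trans (hBn n ξ))) (Real.exp_pos _).le

theorem exp {g : ℝ → ℂ} (hg : IsPositiveMultiplier g) :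
    IsPositiveMultiplier fun ξ => Complex.exp (g ξ) := by
  refine of_tendsto (g := fun n ξ => (1 + g ξ / n) ^ n) (fun n => ?_)
    fun ξ => Complex.tendsto_one_add_div_pow_exp (g ξ)
  have h1 : IsPositiveMultiplier fun ξ => ((1 : ℝ) : ℂ) + (((n : ℝ)⁻¹ : ℝ) : ℂ) * g ξ :=
    (const zero_le_one).add ((const (by positivity)).mul' hg)
  convert h1.pow n using 3 with ξ
  push_cast
  rw [div_eq_inv_mul]

end IsPositiveMultiplier

/-! ### Grünwald–Letnikov approximation and non-negativity of the kernel -/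

/-- The first two factors give b(b - 1) ≥ 0, and every later one, with its sign, is k + 2 - b ≥ 0.
-/
theorem choose_mul_neg_one_pow_nonneg {b : ℝ} (h1 : 1 ≤ b) (h2 : b ≤ 2) (k : ℕ) :
    0 ≤ Ring.choose b (k + 2) * (-1) ^ (k + 2) := by
  have key : ∀ k : ℕ, 0 ≤ (descPochhammer ℤ (k + 2)).smeval b * (-1) ^ (k + 2) := by
    intro k
    induction k with
    | zero =>
      simp [descPochhammer_succ_right, Polynomial.smeval_mul]
      nlinarith
    | succ k ih =>
      have e : (descPochhammer ℤ (k + 1 + 2)).smeval b * (-1) ^ (k + 1 + 2) =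
          ((descPochhammer ℤ (k + 2)).smeval b * (-1) ^ (k + 2)) * (k + 2 - b) := by
        rw [show k + 1 + 2 = (k + 2) + 1 by ring, descPochhammer_succ_right,
          Polynomial.smeval_mul, Polynomial.smeval_sub, Polynomial.smeval_X,
          Polynomial.smeval_natCast]
        simp
        ring
      rw [e]
      have : (0 : ℝ) ≤ k := k.cast_nonneg
      exact mul_nonneg ih (by linarith)
  have h := key k
  rw [Ring.descPochhammer_eq_factorial_smul_choose, nsmul_eq_mul, mul_assoc] at h
  exact nonneg_of_mul_nonneg_right h (by positivity)

theorem hasSum_one_sub_cpow (b : ℝ) {z : ℂ} (hz : ‖z‖ < 1) :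
    HasSum (fun k : ℕ => ((Ring.choose b k * (-1) ^ k : ℝ) : ℂ) * z ^ k) ((1 - z) ^ (b : ℂ)) := by
  have h := (Complex.one_add_cpow_hasFPowerSeriesOnBall_zero (a := (b : ℂ))).hasSum (y := -z)
    (by simpa [enorm_eq_nnnorm, ← NNReal.coe_lt_coe] using hz)
  rw [zero_add, ← sub_eq_add_neg] at h
  refine h.congr_fun fun k => ?_
  rw [binomialSeries_apply, List.prod_ofFn]
  simp [Complex.ofReal_choose, neg_pow z, mul_assoc]

/-- The expansion is z⁻¹ - b + Σ_{j≥2} (-1)^j C(b, j) z^(j-1). The factor z⁻¹ moves the only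
negative coefficient to the constant term, where adding b removes it; δ > 0 gives |z| < 1, hence
convergence. -/
theorem isPositiveMultiplier_one_sub_cpow {b δ : ℝ} (h1 : 1 ≤ b) (h2 : b ≤ 2) (hδ : 0 < δ)
    (h : ℝ) {z : ℝ → ℂ} (hz : ∀ ξ, z ξ = Complex.exp (-(δ + Complex.I * h * ξ))) :
    IsPositiveMultiplier fun ξ => (z ξ)⁻¹ * (1 - z ξ) ^ (b : ℂ) + b := by
  have hz0 : ∀ ξ, z ξ ≠ 0 := fun ξ => by rw [hz]; exact Complex.exp_ne_zero _
  have hz1 : ∀ ξ, ‖z ξ‖ < 1 := fun ξ => by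
    rw [hz, Complex.norm_exp, Real.exp_lt_one_iff]
    simpa using hδ
  have hp : IsPositiveMultiplier z := by
    convert (IsPositiveMultiplier.const (Real.exp_pos (-δ)).le).mul'
      (IsPositiveMultiplier.character (-h)) using 2 with ξ
    rw [hz, Complex.ofReal_exp, ← Complex.exp_add]
    push_cast
    congr 1; ring
  have hi : IsPositiveMultiplier fun ξ => (z ξ)⁻¹ := by
    convert (IsPositiveMultiplier.const (Real.exp_pos δ).le).mul'
      (IsPositiveMultiplier.character h) using 2 with ξ
    rw [hz, Complex.ofReal_exp, ← Complex.exp_add, ← Complex.exp_neg, neg_neg]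
  refine IsPositiveMultiplier.of_tendsto (g := fun n ξ => (z ξ)⁻¹ + ∑ k ∈ Finset.range n,
    ((Ring.choose b (k + 2) * (-1) ^ (k + 2) : ℝ) : ℂ) * z ξ ^ (k + 1)) (fun n => ?_) fun ξ => ?_
  · exact hi.add (IsPositiveMultiplier.sum (fun k => (IsPositiveMultiplier.const
      (choose_mul_neg_one_pow_nonneg h1 h2 k)).mul' (hp.pow _)) n)
  · have hs := (hasSum_nat_add_iff' 2).2 (hasSum_one_sub_cpow b (hz1 ξ))
    have ht := (hs.mul_left (z ξ)⁻¹).tendsto_sum_nat.const_add (z ξ)⁻¹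
    convert ht using 2 with n
    · congr 1
      refine Finset.sum_congr rfl fun k _ => ?_
      rw [pow_succ' (z ξ) (k + 1), mul_left_comm, inv_mul_cancel_left₀ (hz0 ξ)]
    · have := hz0 ξ
      simp [Finset.sum_range_succ]
      field_simp
      ring

theorem isPositiveMultiplier_exp_fracSymbol {α : ℝ} (hα0 : 0 < α) (hα1 : α < 1) {t : ℝ}
    (ht : 0 < t) : IsPositiveMultiplier fun ξ => Complex.exp (fracSymbol α ξ * t) := by
  set b : ℝ := α + 1 with hb
  set h : ℕ → ℝ := fun n => 1 / ((n : ℝ) + 1) with hh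
  have hpos : ∀ n, 0 < h n := fun n => Nat.one_div_pos_of_nat
  have hlim : Filter.Tendsto h Filter.atTop (nhds 0) := tendsto_one_div_add_atTop_nhds_zero_nat
  have hlim' : Filter.Tendsto h Filter.atTop (nhdsWithin 0 {0}ᶜ) :=
    tendsto_nhdsWithin_iff.2 ⟨hlim, Filter.Eventually.of_forall fun n => (hpos n).ne'⟩
  -- The damping h² is of smaller order than h, so it does not affect the derivative at h = 0.
  set z : ℕ → ℝ → ℂ := fun n ξ => Complex.exp (-(((h n ^ 2 : ℝ) : ℂ) + Complex.I * (h n) * ξ)) with hz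
  have hA : ∀ n, IsPositiveMultiplier fun ξ => Complex.exp
      ((((h n)⁻¹ ^ b : ℝ) : ℂ) * ((z n ξ)⁻¹ * (1 - z n ξ) ^ (b : ℂ)) * t) := by
    intro n
    have hq : 0 ≤ t * (h n)⁻¹ ^ b :=
      mul_nonneg ht.le (Real.rpow_nonneg (inv_nonneg.2 (hpos n).le) _)
    have h1 := isPositiveMultiplier_one_sub_cpow (b := b) (by linarith) (by linarith)
      (pow_pos (hpos n) 2) (h n) (z := z n) (fun _ => rfl)
    -- The constant b added to the exponent is paid for by a positive scalar factor.
    convert (IsPositiveMultiplier.const (Real.exp_pos (-(t * (h n)⁻¹ ^ b * b))).le).mul'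
      ((IsPositiveMultiplier.const hq).mul' h1).exp using 2 with ξ
    rw [Complex.ofReal_exp, ← Complex.exp_add]
    congr 1
    push_cast
    ring
  refine IsPositiveMultiplier.of_tendsto hA fun ξ => ?_
  refine (Complex.continuous_exp.tendsto _).comp (Filter.Tendsto.mul_const _ ?_)
  have hder : HasDerivAt (fun s : ℝ => Complex.exp (-(((s ^ 2 : ℝ) : ℂ) + Complex.I * s * ξ)))
      (-(Complex.I * ξ)) 0 := by
    have d1 : HasDerivAt (fun s : ℝ => ((s ^ 2 : ℝ) : ℂ)) ((0 : ℝ) : ℂ) 0 := by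
      simpa using ((hasDerivAt_id (0 : ℝ)).pow 2).ofReal_comp
    have d2 : HasDerivAt (fun s : ℝ => Complex.I * (s : ℂ) * (ξ : ℂ)) (Complex.I * ξ) 0 := by
      simpa using ((hasDerivAt_id (0 : ℝ)).ofReal_comp.const_mul Complex.I).mul_const (ξ : ℂ)
    simpa using (d1.add d2).neg.cexp
  have hz1 : Filter.Tendsto (fun n => z n ξ) Filter.atTop (nhds 1) := by
    have := (hder.continuousAt.tendsto).comp hlim
    simp only [ne_eq, OfNat.ofNat_ne_zero, not_false_eq_true, zero_pow, Complex.ofReal_zero,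
      mul_zero, zero_mul, add_zero, neg_zero, Complex.exp_zero] at this
    exact this
  have hsl : Filter.Tendsto (fun n => (((h n)⁻¹ : ℝ) : ℂ) * (1 - z n ξ)) Filter.atTop
      (nhds (Complex.I * ξ)) := by
    have := (hder.tendsto_slope_zero.comp hlim').neg
    rw [neg_neg] at this
    refine this.congr fun n => ?_
    simp [hz, Complex.real_smul]
    ring
  -- The point iξ is either off the branch cut or 0, where the power is continuous because b > 0.
  have hc := (Complex.continuousAt_cpow_const_of_re_pos (z := Complex.I * ξ) (w := (b : ℂ))
    (Or.inl (by simp)) (by simp; linarith)).tendsto.comp hsl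
  have hfin := (hz1.inv₀ one_ne_zero).mul hc
  rw [inv_one, one_mul] at hfin
  have hs : fracSymbol α ξ = (Complex.I * ξ) ^ (b : ℂ) := by simp [fracSymbol, hb]
  rw [hs]
  refine hfin.congr fun n => ?_
  simp only [Function.comp_apply]
  rw [ofReal_mul_cpow (inv_pos.2 (hpos n))]
  ring

/-- Apply the multiplier to the constant 1 and let the Gaussian parameter tend to 0; the exponential
of the symbol is integrable, so it dominates. -/
theorem fracKernel_nonneg {α : ℝ} (hα0 : 0 < α) (hα1 : α < 1) {t : ℝ} (ht : 0 < t) (x : ℝ) :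
    0 ≤ fracKernel α t x := by
  have hQ := (isPositiveMultiplier_exp_fracSymbol hα0 hα1 ht).mul _ hasNonnegGaussianTransform_one
  simp only [mul_one] at hQ
  have hi : Integrable fun ξ => Complex.exp (fracSymbol α ξ * t) := by
    refine (integrable_fracDensity hα0 hα1 (p := 0) (by norm_num) ht).congr
      (ae_of_all _ fun ξ => ?_)
    simp [fracDensity]
  have hlim : Filter.Tendsto (fun n : ℕ => ∫ ξ : ℝ, Complex.exp (fracSymbol α ξ * t) *
      (Complex.exp (Complex.I * (x : ℂ) * (ξ : ℂ)) *
        Complex.exp (-((1 / ((n : ℝ) + 1) : ℝ) : ℂ) * (ξ : ℂ) ^ 2))) Filter.atTop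
      (nhds (∫ ξ : ℝ, Complex.exp (fracSymbol α ξ * t) *
        Complex.exp (Complex.I * (ξ : ℂ) * (x : ℂ)))) := by
    refine tendsto_integral_of_dominated_convergence _ (fun n => by fun_prop) hi.norm
      (fun n => ae_of_all _ fun ξ => ?_) (ae_of_all _ fun ξ => ?_)
    · rw [norm_mul, norm_exp_mul_gaussian]
      refine mul_le_of_le_one_right (norm_nonneg _) (Real.exp_le_one_iff.2 ?_)
      have : 0 ≤ 1 / ((n : ℝ) + 1) * ξ ^ 2 := by positivity
      linarith
    · have h0 : Filter.Tendsto (fun n : ℕ => ((1 / ((n : ℝ) + 1) : ℝ) : ℂ)) Filter.atTop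
          (nhds ((0 : ℝ) : ℂ)) :=
        (Complex.continuous_ofReal.tendsto 0).comp tendsto_one_div_add_atTop_nhds_zero_nat
      have h1 := (Complex.continuous_exp.tendsto _).comp (h0.neg.mul_const ((ξ : ℂ) ^ 2))
      rw [Complex.ofReal_zero, neg_zero, zero_mul, Complex.exp_zero] at h1
      have h2 := (h1.const_mul (Complex.exp (Complex.I * (x : ℂ) * (ξ : ℂ)))).const_mul
        (Complex.exp (fracSymbol α ξ * t))
      rw [mul_one, mul_right_comm Complex.I] at h2
      refine h2.congr fun n => ?_
      rw [mul_right_comm Complex.I]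
      rfl
  have h0 := ge_of_tendsto' hlim fun n => hQ.nonneg x _ Nat.one_div_pos_of_nat
  rw [fracKernel, invFourierLine]
  refine mul_nonneg ?_ h0
  rw [show (1 / (2 * (Real.pi : ℂ))) = ((1 / (2 * Real.pi) : ℝ) : ℂ) by push_cast; rfl,
    Complex.zero_le_real]
  positivity

end

/-! ### Assembly of the properties -/

theorem mainTheorem7 (α : ℝ) (hα0 : 0 < α) (hα1 : α < 1) :
    -- the kernel is real valued and non-negative
    (∀ t : ℝ, 0 < t → ∀ x : ℝ, (fracKernel α t x).im = 0 ∧ 0 ≤ (fracKernel α t x).re) ∧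
    -- self-similarity
    (∀ t : ℝ, 0 < t → ∀ x : ℝ,
      fracKernel α t x =
        ((1 / t ^ (1 / (1 + α)) : ℝ) : ℂ) * fracKernel α 1 (x / t ^ (1 / (1 + α)))) ∧
    -- mass conservation
    (∀ t : ℝ, 0 < t →
      Integrable (fracKernel α t) ∧ ∫ x : ℝ, ‖fracKernel α t x‖ = 1) ∧
    -- semigroup property
    (∀ a b : ℝ, 0 < a → 0 < b →
      (ConvolutionExists (fracKernel α a) (fracKernel α b) (ContinuousLinearMap.mul ℝ ℂ) volume ∧
        fracKernel α a ⋆[ContinuousLinearMap.mul ℝ ℂ, volume] fracKernel α b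
          = fracKernel α (a + b)) ∧
      (ConvolutionExists (fracKernel α a) (deriv (fracKernel α b))
          (ContinuousLinearMap.mul ℝ ℂ) volume ∧
        fracKernel α a ⋆[ContinuousLinearMap.mul ℝ ℂ, volume] deriv (fracKernel α b)
          = deriv (fracKernel α (a + b)))) ∧
    -- joint smoothness
    ContDiffOn ℝ ∞ (fun p : ℝ × ℝ => fracKernel α p.1 p.2) (Ioi (0 : ℝ) ×ˢ (univ : Set ℝ)) ∧
    -- pointwise bounds on the space derivatives
    (∀ m : ℕ, ∃ B : ℝ, 0 < B ∧ ∀ t : ℝ, 0 < t → ∀ x : ℝ,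
      ‖iteratedDeriv m (fun y : ℝ => fracKernel α t y) x‖ ≤
        1 / t ^ ((1 + (m : ℝ)) / (1 + α)) *
          (B / (1 + t ^ (-((m : ℝ) + 2) / (1 + α)) * |x| ^ (m + 2)))) ∧
    -- the norms in `L¹` of the space derivatives
    (∀ m : ℕ, 1 ≤ m → ∃ C : ℝ, 0 < C ∧ ∀ t : ℝ, 0 < t →
      Integrable (iteratedDeriv m (fun y : ℝ => fracKernel α t y)) ∧
      ∫ x : ℝ, ‖iteratedDeriv m (fun y : ℝ => fracKernel α t y) x‖ =
        C / t ^ ((m : ℝ) / (1 + α))) ∧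
    -- pointwise bounds on the time derivatives
    (∀ m : ℕ, ∃ K : ℝ, 0 < K ∧ ∀ t : ℝ, 0 < t → ∀ x : ℝ,
      ‖iteratedDeriv m (fun s : ℝ => fracKernel α s x) t‖ ≤
        1 / t ^ (((m : ℝ) * (α + 1) + 1) / (α + 1)) *
          (K / (1 + (|x| / t ^ (1 / (α + 1))) ^ 2))) ∧
    -- the norms in `L¹` of the time derivatives
    (∀ m : ℕ, ∃ D : ℝ, 0 < D ∧ ∀ t : ℝ, 0 < t →
      Integrable (fun x : ℝ => iteratedDeriv m (fun s : ℝ => fracKernel α s x) t) ∧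
      ∫ x : ℝ, ‖iteratedDeriv m (fun s : ℝ => fracKernel α s x) t‖ = D / t ^ m) := by
  have hnn : ∀ t : ℝ, 0 < t → ∀ x : ℝ, (fracKernel α t x).im = 0 ∧ 0 ≤ (fracKernel α t x).re :=
    fun t ht x => by
      have h := Complex.le_def.1 (fracKernel_nonneg hα0 hα1 ht x)
      exact ⟨h.2.symm, h.1⟩
  have hK : ∀ t, fracKernel α t = fracMoment α 0 t := fun t => funext fun x =>
    (fracMoment_zero α t x).symm
  have hmass : ∀ t : ℝ, 0 < t → Integrable (fracKernel α t) ∧ ∫ x : ℝ, ‖fracKernel α t x‖ = 1 := by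
    intro t ht
    have hi : Integrable (fracMoment α 0 t) := by
      simpa using integrable_fracMoment_natCast hα0 hα1 0 ht
    -- The integral of the kernel is its transform at ξ = 0, namely e^0 = 1; by non-negativity it is
    -- also the L¹ norm.
    have h1 := integral_fracMoment_mul_exp hα0 hα1 le_rfl ht hi 0
    have h2 : ∀ x, fracMoment α 0 t x = ((‖fracKernel α t x‖ : ℝ) : ℂ) := fun x => by
      obtain ⟨him, hre⟩ := hnn t ht x
      have e : fracKernel α t x = (((fracKernel α t x).re : ℝ) : ℂ) :=
        Complex.ext (by simp) (by simp [him])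
      rw [fracMoment_zero, e, Complex.norm_real, Real.norm_of_nonneg hre]
    simp only [h2] at h1
    have h0 : fracSymbol α 0 = 0 := by
      have h : (α : ℂ) + 1 ≠ 0 := by exact_mod_cast (by linarith : α + 1 ≠ 0)
      simp [fracSymbol, Complex.zero_cpow h]
    simp only [fracDensity, h0, Complex.ofReal_zero, mul_zero, zero_mul, neg_zero,
      Complex.exp_zero, mul_one, Complex.cpow_zero] at h1
    have h3 := integral_ofReal (𝕜 := ℂ) (μ := volume) (f := fun x => ‖fracKernel α t x‖)
    exact ⟨hK t ▸ hi, Complex.ofReal_injective ((h3.symm.trans h1).trans Complex.ofReal_one.symm)⟩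
  have hd : ∀ b : ℝ, 0 < b → deriv (fracKernel α b) = fracMoment α 1 b := fun b hb => by
    have := iteratedDeriv_fracKernel_right hα0 hα1 hb 1
    rwa [iteratedDeriv_one, Nat.cast_one] at this
  have hid : ∀ m : ℕ, ∀ t : ℝ, 0 < t →
      (fun x : ℝ => iteratedDeriv m (fun s : ℝ => fracKernel α s x) t) =
        fracMoment α (m * (α + 1)) t := fun m t ht =>
    funext fun x => iteratedDeriv_fracKernel_left hα0 hα1 x m ht
  have hα : α + 1 ≠ 0 := by linarith
  refine ⟨hnn, fun t ht x => ?_, hmass, fun a b ha hb => ⟨?_, ?_⟩, ?_, fun m => ?_, fun m _ => ?_,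
    fun m => ?_, fun m => ?_⟩
  · simpa [fracMoment_zero] using fracMoment_scaling hα0 0 ht x
  · simp only [hK]
    exact convolution_fracMoment hα0 hα1 le_rfl ha hb
  · rw [hd b hb, hd (a + b) (by positivity), hK]
    exact convolution_fracMoment hα0 hα1 zero_le_one ha hb
  · simp only [hK]
    exact contDiffOn_infty.2 fun n => contDiffOn_fracMoment hα0 hα1 n (by norm_num)
  · obtain ⟨B, hB, h⟩ := exists_norm_fracMoment_natCast_le_div hα0 hα1 m
    refine ⟨B, hB, fun t ht x => ?_⟩
    have hr := Real.rpow_pos_of_pos ht (1 / (1 + α))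
    have e : t ^ (-((m : ℝ) + 2) / (1 + α)) * |x| ^ (m + 2) =
        |x / t ^ (1 / (1 + α))| ^ (m + 2) := by
      rw [abs_div, abs_of_pos hr, div_pow, ← Real.rpow_natCast (t ^ _), ← Real.rpow_mul ht.le,
        neg_div, Real.rpow_neg ht.le, div_eq_mul_inv, mul_comm]
      congr 3
      push_cast; ring
    rw [iteratedDeriv_fracKernel_right hα0 hα1 ht, fracMoment_scaling hα0 _ ht, norm_mul,
      Complex.norm_real, Real.norm_of_nonneg (by positivity), e, add_comm 1 (m : ℝ)]
    exact mul_le_mul_of_nonneg_left (h _) (by positivity)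
  -- The constant is the L¹ norm at time 1; scaling supplies the power of t.
  · refine ⟨∫ x, ‖fracMoment α m 1 x‖, integral_norm_fracMoment_pos hα0 hα1 m.cast_nonneg one_pos
      (integrable_fracMoment_natCast hα0 hα1 m one_pos), fun t ht => ?_⟩
    rw [iteratedDeriv_fracKernel_right hα0 hα1 ht]
    exact ⟨integrable_fracMoment_natCast hα0 hα1 m ht, integral_norm_fracMoment hα0 ht⟩
  · obtain ⟨B, hB, h⟩ := exists_norm_fracMoment_natCast_mul_le_div hα0 hα1 m
    refine ⟨B, hB, fun t ht x => ?_⟩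
    have hr := Real.rpow_pos_of_pos ht (1 / (1 + α))
    rw [iteratedDeriv_fracKernel_left hα0 hα1 x m ht, fracMoment_scaling hα0 _ ht, norm_mul,
      Complex.norm_real, Real.norm_of_nonneg (by positivity), add_comm α 1]
    have h1 := h (x / t ^ (1 / (1 + α)))
    rw [abs_div, abs_of_pos hr, add_comm α 1] at h1
    exact mul_le_mul_of_nonneg_left h1 (by positivity)
  · refine ⟨∫ x, ‖fracMoment α (m * (α + 1)) 1 x‖, integral_norm_fracMoment_pos hα0 hα1
      (by positivity) one_pos (integrable_fracMoment_natCast_mul hα0 hα1 m one_pos),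
      fun t ht => ?_⟩
    have h1 := integral_norm_fracMoment hα0 (p := m * (α + 1)) ht
    rw [add_comm 1 α, mul_div_cancel_right₀ _ hα, Real.rpow_natCast] at h1
    rw [hid m t ht]
    refine ⟨integrable_fracMoment_natCast_mul hα0 hα1 m ht, ?_⟩
    rw [← h1]
    exact integral_congr_ae (ae_of_all _ fun x => by rw [← hid m t ht])
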